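/- Let $Q=(q_n)_{n\ge 1}$ be a sequence of integers $q_n\ge 2$ that is infinite in limit, i.e. $\lim_{n\to\infty}q_n=\infty$. For $x\in\mathbb{R}$ and $n\ge 0$ let $T_{Q,n}(x)\in[0,1)$ be the fractional part of $q_nq_{n-1}\cdots q_1x$ (so $T_{Q,0}(x)$ is the fractional part of $x$). An asymptotic distribution function (adf) is a non-decreasing function $f:[0,1]\to[0,1]$ with $f(0)=0$ and $f(1)=1$. A sequence $(\omega_n)_{n\ge 0}$ in $[0,1)$ has adf $f$ if $$\lim_{n\to\infty}\frac{\#\{0\le i<n:\ \omega_i\in[0,t)\}}{n}=f(t)\qquad\text{for every } t\in[0,1].$$ Theorem. For every such $Q$ and every adf $f$, the set of all $x\in\mathbb{R}$ such that the sequence $(T_{Q,n}(x))_{n\ge 0}$ has adf $f$ has full Hausdorff dimension, i.e. Hausdorff dimension $1$. -/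

import Mathlib

open Filter Topology

namespace CantorSeries

/-- A basic sequence `(q_n)_{n ≥ 1}` of integers `q_n ≥ 2`. The sequence is indexed from `1`;
the value `q 0` plays no role. -/
def IsBasicSequence (q : ℕ → ℕ) : Prop :=
  ∀ n, 1 ≤ n → 2 ≤ q n

/-- The sequence is infinite in limit: `q_n → ∞`. -/
def InfiniteInLimit (q : ℕ → ℕ) : Prop :=
  Tendsto q atTop atTop

/-- `T_{Q,n}(x) = q_n q_{n-1} ⋯ q_1 x (mod 1)`, taken in `[0, 1)`. In particular
`T_{Q,0}(x) = x (mod 1)`. -/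
noncomputable def T (q : ℕ → ℕ) (n : ℕ) (x : ℝ) : ℝ :=
  Int.fract (((∏ i ∈ Finset.Icc 1 n, q i : ℕ) : ℝ) * x)

/-- An asymptotic distribution function: a non-decreasing `f : [0,1] → [0,1]` with `f 0 = 0` and
`f 1 = 1` (values outside `[0,1]` are irrelevant). -/
structure IsADF (f : ℝ → ℝ) : Prop where
  mapsTo : Set.MapsTo f (Set.Icc 0 1) (Set.Icc 0 1)
  monotoneOn : MonotoneOn f (Set.Icc 0 1)
  map_zero : f 0 = 0
  map_one : f 1 = 1

open Classical in
/-- The number of indices among the first `n` terms `ω 0, …, ω (n - 1)` of the sequence for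
which the term lies in `I`. -/
noncomputable def A (n : ℕ) (I : Set ℝ) (ω : ℕ → ℝ) : ℕ :=
  ((Finset.range n).filter fun i => ω i ∈ I).card

/-- The sequence `ω` (with terms in `[0,1)`) has asymptotic distribution function `f`. -/
def HasADF (ω : ℕ → ℝ) (f : ℝ → ℝ) : Prop :=
  ∀ x ∈ Set.Icc (0 : ℝ) 1,
    Tendsto (fun n : ℕ => (A n (Set.Ico 0 x) ω : ℝ) / (n : ℝ)) atTop (𝓝 (f x))

end CantorSeries

/-! Put `b n = q (n + 1)`. The `n`-th orbit point of `x` is the `n`-th remainder of its expansion in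
the bases `b`, and its position is known up to `1 / b n` from the `n`-th digit alone. So the orbit
can be steered by choosing digits: restrict the `n`-th digit to a window of `m n` consecutive values
with `m n / b n → 0`, placed near a prescribed target `g n`.

Distribution. Let `u n` be uniformly distributed (`blockSeq`) and let `g n` be a generalized inverse
of `f` at `u n` (`IsADF.exists_threshold`). Up to small errors, the orbit lies below `t` exactly
when `u n < f t`, which has frequency `f t`. As `f` may jump, with any value at the jump, the window
must also lie on the correct side of `g n`; this is `IsNear`, and `IsADF.hasADF_of_isNear`
concludes.

Dimension. Reading the base-`m` digits of `y ∈ [0, 1)` as positions inside the windows maps `[0, 1)`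
into the window set with an `r`-Hölder inverse, provided `m` is large enough
(`LargeWindows.le_dimH_windowSet`). If `b n / m n` tends to infinity slowly enough, this works for
every `r < 1` with the same windows (`largeWindows_windowSize`). -/

namespace CantorSeries

/-! ### Expansions in variable bases -/

/-- The product of the first `n` bases. -/
def scale (b : ℕ → ℕ) (n : ℕ) : ℕ := ∏ i ∈ Finset.range n, b i

theorem scale_succ (b : ℕ → ℕ) (n : ℕ) : scale b (n + 1) = scale b n * b n :=
  Finset.prod_range_succ _ _

theorem scale_zero (b : ℕ → ℕ) : scale b 0 = 1 := rfl

theorem scale_pos {b : ℕ → ℕ} (hb : ∀ n, 1 ≤ b n) (n : ℕ) : 0 < scale b n :=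
  Finset.prod_pos fun i _ => hb i

theorem two_pow_le_scale {b : ℕ → ℕ} (hb : ∀ n, 2 ≤ b n) (n : ℕ) : 2 ^ n ≤ scale b n := by
  simpa [scale] using Finset.prod_le_prod' (s := Finset.range n) (f := fun _ => 2) fun i _ => hb i

theorem T_eq_fract_scale (q : ℕ → ℕ) (n : ℕ) (x : ℝ) :
    T q n x = Int.fract ((scale (fun i => q (i + 1)) n : ℝ) * x) := by
  have h : ∏ i ∈ Finset.Icc 1 n, q i = scale (fun i => q (i + 1)) n := by
    induction n with
    | zero => simp [scale]
    | succ n ih => rw [Finset.prod_Icc_succ_top (by omega), ih, scale_succ]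
  rw [T, h]

/-- `θ n` are the remainders of the expansion of `θ 0` with digits `e n` in the bases `b n`. -/
structure IsExpansion (b e : ℕ → ℕ) (θ : ℕ → ℝ) : Prop where
  nonneg : ∀ n, 0 ≤ θ n
  lt_one : ∀ n, θ n < 1
  step : ∀ n, (b n : ℝ) * θ n = e n + θ (n + 1)

namespace IsExpansion

variable {b e e' : ℕ → ℕ} {θ θ' : ℕ → ℝ}

theorem digit_lt (h : IsExpansion b e θ) (hb : ∀ n, 1 ≤ b n) (n : ℕ) : e n < b n := by
  have h1 := h.step n
  have h2 := h.nonneg (n + 1)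
  have h3 : (b n : ℝ) * θ n < b n := by
    have : (0 : ℝ) < b n := by exact_mod_cast hb n
    nlinarith [h.lt_one n]
  have : (e n : ℝ) < b n := by linarith
  exact_mod_cast this

theorem fract_scale_mul (h : IsExpansion b e θ) (n : ℕ) :
    Int.fract ((scale b n : ℝ) * θ 0) = θ n := by
  have key : ∃ z : ℤ, (scale b n : ℝ) * θ 0 = z + θ n := by
    induction n with
    | zero => exact ⟨0, by simp [scale_zero]⟩
    | succ n ih =>
      obtain ⟨z, hz⟩ := ih
      refine ⟨b n * z + e n, ?_⟩
      rw [scale_succ]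
      push_cast
      linear_combination (b n : ℝ) * hz + h.step n
  obtain ⟨z, hz⟩ := key
  rw [hz, Int.fract_intCast_add, Int.fract_eq_self]
  exact ⟨h.nonneg n, h.lt_one n⟩

theorem scale_mul_sub (h : IsExpansion b e θ) (h' : IsExpansion b e' θ') {n : ℕ}
    (he : ∀ k < n, e k = e' k) : (scale b n : ℝ) * (θ 0 - θ' 0) = θ n - θ' n := by
  induction n with
  | zero => simp [scale_zero]
  | succ n ih =>
    have h1 := ih fun k hk => he k (by omega)
    have h2 : (e n : ℝ) = e' n := by rw [he n (by omega)]
    rw [scale_succ]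
    push_cast
    linear_combination (b n : ℝ) * h1 + h.step n - h'.step n + h2

theorem mem_window {a m : ℕ → ℕ} (h : IsExpansion b (fun n => a n + e n) θ)
    (hb : ∀ n, 1 ≤ b n) (he : ∀ n, e n < m n) (n : ℕ) :
    θ n ∈ Set.Ico ((a n : ℝ) / b n) ((a n + m n : ℝ) / b n) := by
  have hb0 : (0 : ℝ) < b n := by exact_mod_cast hb n
  have h1 := h.step n
  have h2 : (e n : ℝ) + 1 ≤ m n := by exact_mod_cast he n
  have h3 := h.nonneg (n + 1)
  have h4 := h.lt_one (n + 1)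
  have h5 : (0 : ℝ) ≤ e n := Nat.cast_nonneg _
  push_cast at h1
  constructor
  · rw [div_le_iff₀ hb0]; linarith
  · rw [lt_div_iff₀ hb0]; linarith

end IsExpansion

theorem exists_isExpansion_of_mem_Ico (b : ℕ → ℕ) {y : ℝ}
    (hy : y ∈ Set.Ico (0 : ℝ) 1) : ∃ e θ, IsExpansion b e θ ∧ θ 0 = y := by
  refine ⟨fun n => ⌊(b n : ℝ) * Int.fract ((scale b n : ℝ) * y)⌋₊,
    fun n => Int.fract ((scale b n : ℝ) * y),
    ⟨fun n => Int.fract_nonneg _, fun n => Int.fract_lt_one _, fun n => ?_⟩, ?_⟩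
  · have h0 : 0 ≤ (b n : ℝ) * Int.fract ((scale b n : ℝ) * y) := by positivity
    have h1 : Int.fract ((scale b (n + 1) : ℝ) * y)
        = Int.fract ((b n : ℝ) * Int.fract ((scale b n : ℝ) * y)) := by
      rw [Int.fract_eq_fract]
      refine ⟨b n * ⌊(scale b n : ℝ) * y⌋, ?_⟩
      rw [scale_succ, ← Int.self_sub_floor]
      push_cast
      ring
    simp only [h1]
    rw [natCast_floor_eq_intCast_floor h0, Int.floor_add_fract]
  · simpa [scale_zero, Int.fract_eq_self] using hy

/-- The margin 2 never allows the maximal digit. Nested intervals only give remainders at most 1;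
one more step gives `b n * θ n ≤ (b n - 2) + 1 < b n`, hence strictness. -/
theorem exists_isExpansion_of_digits {b e : ℕ → ℕ} (he : ∀ n, e n + 2 ≤ b n) :
    ∃ θ, IsExpansion b e θ := by
  have hb : ∀ n, 1 ≤ b n := fun n => by have := he n; omega
  have hQ : ∀ n, (0 : ℝ) < scale b n := fun n => by exact_mod_cast scale_pos hb n
  have hb0 : ∀ n, (0 : ℝ) < b n := fun n => by exact_mod_cast hb n
  set S : ℕ → ℝ := fun n => ∑ i ∈ Finset.range n, (e i : ℝ) / scale b (i + 1) with hS
  have hSs : ∀ n, S (n + 1) = S n + (e n : ℝ) / scale b (n + 1) := fun n =>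
    Finset.sum_range_succ _ _
  have hmono : Monotone S := monotone_nat_of_le_succ fun n => by
    rw [hSs]; have := hQ (n + 1); linarith [div_nonneg (Nat.cast_nonneg (e n)) this.le]
  have hanti : Antitone fun n => S n + 1 / scale b n := antitone_nat_of_succ_le fun n => by
    have h1 : (1 : ℝ) / scale b n = b n / scale b (n + 1) := by
      rw [scale_succ]; push_cast; field_simp [(hQ n).ne', (hb0 n).ne']
    have h2 : (e n : ℝ) + 2 ≤ b n := by exact_mod_cast he n
    rw [hSs, h1, add_assoc, ← add_div]
    have := hQ (n + 1)
    gcongr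
    linarith
  have hx := hmono.ciSup_mem_iInter_Icc_of_antitone hanti fun n => by
    have := hQ n; simp
  set x := ⨆ n, S n
  simp only [Set.mem_iInter, Set.mem_Icc] at hx
  have hstep : ∀ n, (b n : ℝ) * (scale b n * (x - S n))
      = e n + scale b (n + 1) * (x - S (n + 1)) := fun n => by
    rw [hSs, scale_succ]; push_cast
    field_simp [(hQ n).ne', (hb0 n).ne']
    ring
  have hle : ∀ n, (scale b n : ℝ) * (x - S n) ≤ 1 := fun n => by
    have h1 : x - S n ≤ 1 / scale b n := by linarith [(hx n).2]
    rw [le_div_iff₀ (hQ n)] at h1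
    linarith
  refine ⟨fun n => scale b n * (x - S n), fun n => mul_nonneg (hQ n).le (by linarith [(hx n).1]),
    fun n => ?_, hstep⟩
  have h1 := hstep n
  have h2 := hle (n + 1)
  have h3 : (e n : ℝ) + 2 ≤ b n := by exact_mod_cast he n
  by_contra! hcon
  nlinarith [hb0 n]

/-! ### Hausdorff dimension of window sets -/

theorem dimH_le_dimH_image_div {h : ℝ → ℝ} {s : Set ℝ} {C r : NNReal} (hr : 0 < r)
    (H : ∀ y ∈ s, ∀ y' ∈ s, dist y y' ≤ C * dist (h y) (h y') ^ (r : ℝ)) :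
    dimH s ≤ dimH (h '' s) / r := by
  have hinj : Set.InjOn h s := fun y hy y' hy' heq => by
    have := H y hy y' hy'
    rw [heq, dist_self, Real.zero_rpow (by positivity), mul_zero] at this
    exact dist_le_zero.1 this
  have hg : HolderOnWith C r (Function.invFunOn h s) (h '' s) := by
    rintro _ ⟨y, hy, rfl⟩ _ ⟨y', hy', rfl⟩
    rw [hinj.leftInvOn_invFunOn hy, hinj.leftInvOn_invFunOn hy', edist_dist, edist_dist,
      ENNReal.ofReal_rpow_of_nonneg dist_nonneg (NNReal.coe_nonneg r), ← ENNReal.ofReal_coe_nnreal,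
      ← ENNReal.ofReal_mul C.coe_nonneg]
    exact ENNReal.ofReal_le_ofReal (H y hy y' hy')
  have := hg.dimH_image_le hr
  rwa [hinj.leftInvOn_invFunOn.image_image] at this

/-- The points whose orbit under multiplication by the bases stays in prescribed windows. -/
def windowSet (b a m : ℕ → ℕ) : Set ℝ :=
  {x | ∀ n, Int.fract ((scale b n : ℝ) * x) ∈ Set.Ico ((a n : ℝ) / b n) ((a n + m n : ℝ) / b n)}

/-- The window sizes `m` are large enough compared to the bases `b` for dimension `r`. -/
def LargeWindows (b m : ℕ → ℕ) (r : ℝ) : Prop :=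
  ∃ C : ℝ, ∀ n, (scale b n : ℝ) ^ r * ((b n : ℝ) / m n) ^ r ≤ C * scale m n

/-- If the first differing digits differ by `d`, the `φ`-distance is at most `2 d / scale m (n +
1)`, while the `θ`-distance is at least `d / (2 * scale b (n + 1))`. The bound `hC` compares the
first with the `r`-th power of the second. -/
theorem IsExpansion.dist_le_of_common_prefix {b a m e e' : ℕ → ℕ} {φ φ' θ θ' : ℕ → ℝ} {C r : ℝ}
    (hr0 : 0 < r) (hr1 : r < 1) (hm : ∀ n, 1 ≤ m n) (hmb : ∀ n, 2 * m n ≤ b n)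
    (hC : ∀ n, (scale b n : ℝ) ^ r * ((b n : ℝ) / m n) ^ r ≤ C * scale m n)
    (h : IsExpansion m e φ) (h' : IsExpansion m e' φ')
    (k : IsExpansion b (fun n => a n + e n) θ) (k' : IsExpansion b (fun n => a n + e' n) θ')
    {n : ℕ} (hlt : ∀ i < n, e i = e' i) (hne : e n ≠ e' n) :
    dist (φ 0) (φ' 0) ≤ 4 * C * dist (θ 0) (θ' 0) ^ r := by
  have hb : ∀ n, 1 ≤ b n := fun n => by have := hmb n; have := hm n; omega
  have hQ : (0 : ℝ) < scale b n := by exact_mod_cast scale_pos hb n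
  have hP : (0 : ℝ) < scale m n := by exact_mod_cast scale_pos hm n
  have hbn : (0 : ℝ) < b n := by exact_mod_cast hb n
  have hmn : (0 : ℝ) < m n := by exact_mod_cast hm n
  set d : ℝ := |(e n : ℝ) - e' n| with hd
  have hd1 : 1 ≤ d := by
    have : (1 : ℤ) ≤ |(e n : ℤ) - e' n| := Int.one_le_abs (by omega)
    rw [hd]; exact_mod_cast this
  have hdm : d ≤ m n := by
    have h1 : (e n : ℝ) < m n := by exact_mod_cast h.digit_lt hm n
    have h2 : (e' n : ℝ) < m n := by exact_mod_cast h'.digit_lt hm n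
    rw [hd, abs_le]
    constructor <;> linarith [Nat.cast_nonneg (α := ℝ) (e n), Nat.cast_nonneg (α := ℝ) (e' n)]
  have hup : dist (φ 0) (φ' 0) ≤ 2 * d / (scale m n * m n) := by
    rw [le_div_iff₀ (by positivity)]
    have h1 : (φ 0 - φ' 0) * (scale m n * m n)
        = (e n - e' n) + (φ (n + 1) - φ' (n + 1)) := by
      linear_combination (m n : ℝ) * h.scale_mul_sub h' hlt + h.step n - h'.step n
    have h2 : |φ (n + 1) - φ' (n + 1)| ≤ 1 := by
      rw [abs_le]
      constructor <;> linarith [h.nonneg (n + 1), h.lt_one (n + 1), h'.nonneg (n + 1),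
        h'.lt_one (n + 1)]
    calc dist (φ 0) (φ' 0) * (scale m n * m n)
        = |(φ 0 - φ' 0) * (scale m n * m n)| := by
          rw [abs_mul, Real.dist_eq, abs_of_pos (mul_pos hP hmn)]
      _ ≤ d + |φ (n + 1) - φ' (n + 1)| := by rw [h1]; exact abs_add_le _ _
      _ ≤ 2 * d := by linarith
  have hlow : d / (2 * (scale b n * b n)) ≤ dist (θ 0) (θ' 0) := by
    have hlt' : ∀ i < n, a i + e i = a i + e' i := fun i hi => by rw [hlt i hi]
    have h1 : (θ 0 - θ' 0) * (scale b n * b n)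
        = (e n - e' n) + (θ (n + 1) - θ' (n + 1)) := by
      have h2 := k.step n
      have h3 := k'.step n
      push_cast at h2 h3
      linear_combination (b n : ℝ) * k.scale_mul_sub k' hlt' + h2 - h3
    -- Both remainders lie in the same window, of length at most 1/2, so they cannot cancel the
    -- digit difference `d ≥ 1`.
    have h2 : |θ (n + 1) - θ' (n + 1)| ≤ 1 / 2 := by
      have h3 := k.mem_window hb (h.digit_lt hm) (n + 1)
      have h4 := k'.mem_window hb (h'.digit_lt hm) (n + 1)
      have hw : (m (n + 1) : ℝ) / b (n + 1) ≤ 1 / 2 := by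
        rw [div_le_div_iff₀ (by exact_mod_cast hb _) (by norm_num)]
        have := hmb (n + 1)
        have : (2 : ℝ) * m (n + 1) ≤ b (n + 1) := by exact_mod_cast this
        linarith
      rw [add_div] at h3 h4
      rw [abs_le]
      constructor <;> linarith [h3.1, h3.2, h4.1, h4.2]
    rw [div_le_iff₀ (by positivity)]
    have h5 : dist (θ 0) (θ' 0) * (scale b n * b n)
        = |(e n - e' n : ℝ) + (θ (n + 1) - θ' (n + 1))| := by
      rw [← h1, abs_mul, Real.dist_eq, abs_of_pos (mul_pos hQ hbn)]
    have h6 := abs_sub_abs_le_abs_sub ((e n : ℝ) - e' n) (-(θ (n + 1) - θ' (n + 1)))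
    rw [abs_neg, sub_neg_eq_add] at h6
    have : d / 2 ≤ dist (θ 0) (θ' 0) * (scale b n * b n) := by rw [h5]; linarith
    linarith
  have hC0 : 0 ≤ C := by
    have h1 := (by positivity : (0 : ℝ) ≤ (scale b n : ℝ) ^ r * ((b n : ℝ) / m n) ^ r).trans (hC n)
    exact nonneg_of_mul_nonneg_left h1 hP
  -- Since `d ≤ m n`, the factor `d / m n` may be raised to the power `r`; the cost left over at
  -- place `n` is then only `(b n / m n) ^ r`.
  have hdm' : d / m n ≤ (d / m n) ^ r := by
    have h0 : 0 < d / m n := by positivity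
    have h1 : d / m n ≤ 1 := (div_le_one hmn).2 hdm
    simpa using Real.rpow_le_rpow_of_exponent_ge h0 h1 hr1.le
  set w : ℝ := d / (2 * (scale b n * b n)) with hw
  have hw0 : 0 ≤ w := by positivity
  have hpow : (d / m n) ^ r = w ^ r * 2 ^ r * ((scale b n : ℝ) ^ r * ((b n : ℝ) / m n) ^ r) := by
    rw [← Real.mul_rpow hQ.le (by positivity), ← Real.mul_rpow hw0 (by norm_num),
      ← Real.mul_rpow (by positivity) (by positivity), hw]
    congr 1
    field_simp
  have h2r : (2 : ℝ) ^ r ≤ 2 := by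
    simpa using Real.rpow_le_rpow_of_exponent_le (x := 2) (by norm_num) hr1.le
  calc dist (φ 0) (φ' 0) ≤ 2 * d / (scale m n * m n) := hup
    _ = 2 / scale m n * (d / m n) := by field_simp
    _ ≤ 2 / scale m n * (w ^ r * 2 * (C * scale m n)) := by
        gcongr
        rw [hpow] at hdm'
        exact hdm'.trans (mul_le_mul (by gcongr) (hC n) (by positivity) (by positivity))
    _ = 4 * C * w ^ r := by field_simp; ring
    _ ≤ 4 * C * dist (θ 0) (θ' 0) ^ r := by gcongr

theorem IsExpansion.eq_of_digits_eq {m e : ℕ → ℕ} {φ φ' : ℕ → ℝ}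
    (hm : Tendsto (fun n => (scale m n : ℝ)) atTop atTop) (h : IsExpansion m e φ)
    (h' : IsExpansion m e φ') : φ 0 = φ' 0 := by
  by_contra hne
  have hpos : 0 < |φ 0 - φ' 0| := abs_pos.2 (sub_ne_zero.2 hne)
  obtain ⟨n, hn⟩ := (hm.eventually_ge_atTop (1 / |φ 0 - φ' 0|)).exists
  rw [div_le_iff₀ hpos] at hn
  have h1 : (scale m n : ℝ) * |φ 0 - φ' 0| = |φ n - φ' n| := by
    rw [← h.scale_mul_sub h' (n := n) fun _ _ => rfl, abs_mul, Nat.abs_cast]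
  have h2 : |φ n - φ' n| < 1 := by
    rw [abs_lt]
    constructor <;> linarith [h.nonneg n, h.lt_one n, h'.nonneg n, h'.lt_one n]
  linarith

/-- Some `m n` may equal 1, so growth is not automatic; it is inherited from `scale b n ≥ 2 ^ n`. -/
theorem LargeWindows.tendsto_scale {b m : ℕ → ℕ} {r : ℝ} (hr : 0 < r) (hm : ∀ n, 1 ≤ m n)
    (hmb : ∀ n, 2 * m n ≤ b n) (H : LargeWindows b m r) :
    Tendsto (fun n => (scale m n : ℝ)) atTop atTop := by
  obtain ⟨C, hC⟩ := H
  have hC0 : 0 < max C 1 := by positivity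
  have hlow : ∀ n, ((2 : ℝ) ^ r) ^ n / max C 1 ≤ scale m n := fun n => by
    have hmn : (0 : ℝ) < m n := by exact_mod_cast hm n
    have hP : (0 : ℝ) < scale m n := by exact_mod_cast scale_pos hm n
    rw [div_le_iff₀ hC0]
    have h1 : ((2 : ℝ) ^ r) ^ n ≤ (scale b n : ℝ) ^ r := by
      rw [← Real.rpow_natCast, ← Real.rpow_mul (by norm_num), mul_comm, Real.rpow_mul (by norm_num)]
      refine Real.rpow_le_rpow (by positivity) ?_ hr.le
      rw [Real.rpow_natCast]
      exact_mod_cast two_pow_le_scale (fun n => by have := hmb n; have := hm n; omega) n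
    have h2 : 1 ≤ ((b n : ℝ) / m n) ^ r := by
      refine Real.one_le_rpow ?_ hr.le
      rw [one_le_div hmn]
      have := hmb n
      exact_mod_cast (by omega : m n ≤ b n)
    calc ((2 : ℝ) ^ r) ^ n ≤ (scale b n : ℝ) ^ r * 1 := by simpa using h1
      _ ≤ (scale b n : ℝ) ^ r * ((b n : ℝ) / m n) ^ r := by gcongr
      _ ≤ C * scale m n := hC n
      _ ≤ scale m n * max C 1 := by rw [mul_comm]; gcongr; exact le_max_left _ _
  refine tendsto_atTop_mono hlow ?_
  exact (tendsto_pow_atTop_atTop_of_one_lt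
    (Real.one_lt_rpow (by norm_num) hr)).atTop_div_const hC0

theorem LargeWindows.le_dimH_windowSet {b a m : ℕ → ℕ} {r : NNReal} (hr0 : 0 < r) (hr1 : r < 1)
    (hm : ∀ n, 1 ≤ m n) (hmb : ∀ n, 2 * m n ≤ b n) (hab : ∀ n, a n + m n + 1 ≤ b n)
    (H : LargeWindows b m r) : (r : ENNReal) ≤ dimH (windowSet b a m) := by
  have hb : ∀ n, 1 ≤ b n := fun n => by have := hab n; omega
  have hex : ∀ y : ℝ, ∃ e φ θ, y ∈ Set.Ico (0 : ℝ) 1 →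
      φ 0 = y ∧ IsExpansion m e φ ∧ IsExpansion b (fun n => a n + e n) θ := fun y => by
    by_cases hy : y ∈ Set.Ico (0 : ℝ) 1
    · obtain ⟨e, φ, h, h0⟩ := exists_isExpansion_of_mem_Ico m hy
      obtain ⟨θ, hθ⟩ := exists_isExpansion_of_digits (b := b) (e := fun n => a n + e n) fun n => by
        have := h.digit_lt hm n; have := hab n; omega
      exact ⟨e, φ, θ, fun _ => ⟨h0, h, hθ⟩⟩
    · exact ⟨0, 0, 0, fun h => absurd h hy⟩
  choose e φ θ hext using hex
  have htend := H.tendsto_scale (by exact_mod_cast hr0) hm hmb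
  obtain ⟨C, hC⟩ := H
  have hmain : ∀ y ∈ Set.Ico (0 : ℝ) 1, ∀ y' ∈ Set.Ico (0 : ℝ) 1,
      dist y y' ≤ (4 * C).toNNReal * dist (θ y 0) (θ y' 0) ^ (r : ℝ) := by
    intro y hy y' hy'
    obtain ⟨h0, h, k⟩ := hext y hy
    obtain ⟨h0', h', k'⟩ := hext y' hy'
    by_cases heq : e y = e y'
    · rw [← heq] at h'
      have := h.eq_of_digits_eq htend h'
      rw [h0, h0'] at this
      rw [this, dist_self]
      positivity
    · classical
      have hex' : ∃ n, e y n ≠ e y' n := by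
        by_contra! hall; exact heq (funext hall)
      have := h.dist_le_of_common_prefix (by exact_mod_cast hr0) (by exact_mod_cast hr1) hm hmb hC
        h' k k' (n := Nat.find hex') (fun i hi => not_not.1 (Nat.find_min hex' hi))
        (Nat.find_spec hex')
      rw [h0, h0'] at this
      refine this.trans ?_
      gcongr
      exact Real.le_coe_toNNReal _
  have hdim := dimH_le_dimH_image_div hr0 hmain
  have hone : dimH (Set.Ico (0 : ℝ) 1) = 1 := by
    rw [Real.dimH_of_nonempty_interior (by simp)]; simp
  have hsub : (fun y => θ y 0) '' Set.Ico (0 : ℝ) 1 ⊆ windowSet b a m := by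
    rintro _ ⟨y, hy, rfl⟩ n
    obtain ⟨h0, h, k⟩ := hext y hy
    rw [k.fract_scale_mul]
    exact k.mem_window hb (h.digit_lt hm) n
  rw [hone, ENNReal.le_div_iff_mul_le (by left; exact_mod_cast hr0.ne') (by left; simp),
    one_mul] at hdim
  exact hdim.trans (dimH_mono hsub)

/-! ### Choice of the window sizes -/

/-- The reciprocal of the proportion of digits allowed at place `n`. -/
def windowDivisor (b : ℕ → ℕ) (n : ℕ) : ℕ := min (n + 1) (Nat.log 2 (b n)) + 1

/-- The number of digits allowed at place `n`. -/
def windowSize (b : ℕ → ℕ) (n : ℕ) : ℕ := b n / windowDivisor b n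

theorem exists_bound_of_eventually_antitone {R : ℕ → ℝ} (h : ∀ᶠ n in atTop, R (n + 1) ≤ R n) :
    ∃ C, ∀ n, R n ≤ C := by
  obtain ⟨N, hN⟩ := eventually_atTop.1 h
  obtain ⟨C, hC⟩ := ((Finset.range (N + 1)).image R).bddAbove
  refine ⟨C, fun n => ?_⟩
  have hsmall : ∀ n ≤ N, R n ≤ C := fun n hn =>
    hC (Finset.mem_coe.2 (Finset.mem_image_of_mem R (Finset.mem_range.2 (by omega))))
  rcases le_total n N with hn | hn
  · exact hsmall n hn
  · induction n, hn using Nat.le_induction with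
    | base => exact hsmall N le_rfl
    | succ n hn ih => exact (hN n hn).trans ih

theorem two_le_windowDivisor {b : ℕ → ℕ} (hb : ∀ n, 2 ≤ b n) (n : ℕ) : 2 ≤ windowDivisor b n := by
  have : 1 ≤ Nat.log 2 (b n) := Nat.log_pos (by norm_num) (hb n)
  unfold windowDivisor
  omega

theorem windowDivisor_le {b : ℕ → ℕ} (hb : ∀ n, 2 ≤ b n) (n : ℕ) : windowDivisor b n ≤ b n := by
  have h1 : Nat.log 2 (b n) < 2 ^ Nat.log 2 (b n) := Nat.lt_two_pow_self
  have h2 : 2 ^ Nat.log 2 (b n) ≤ b n := Nat.pow_log_le_self 2 (by have := hb n; omega)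
  unfold windowDivisor
  omega

theorem one_le_windowSize {b : ℕ → ℕ} (hb : ∀ n, 2 ≤ b n) (n : ℕ) : 1 ≤ windowSize b n :=
  Nat.div_pos (windowDivisor_le hb n) (by have := two_le_windowDivisor hb n; omega)

theorem two_mul_windowSize_le {b : ℕ → ℕ} (hb : ∀ n, 2 ≤ b n) (n : ℕ) : 2 * windowSize b n ≤ b n :=
  (Nat.mul_le_mul_right _ (two_le_windowDivisor hb n)).trans (Nat.mul_div_le _ _)

theorem div_windowSize_le {b : ℕ → ℕ} (hb : ∀ n, 2 ≤ b n) (n : ℕ) : (b n : ℝ) / windowSize b n ≤ 2 * windowDivisor b n := by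
  have hm := one_le_windowSize hb n
  rw [div_le_iff₀ (by exact_mod_cast hm)]
  have h1 : b n < windowDivisor b n * windowSize b n + windowDivisor b n := by
    have := two_le_windowDivisor hb n
    exact Nat.lt_mul_div_succ (b n) (by omega)
  have h2 : windowDivisor b n ≤ windowDivisor b n * windowSize b n := Nat.le_mul_of_pos_right _ hm
  have h3 : b n ≤ 2 * windowDivisor b n * windowSize b n := by rw [mul_assoc]; omega
  exact_mod_cast h3

theorem tendsto_windowDivisor {b : ℕ → ℕ} (hlim : Tendsto b atTop atTop) :
    Tendsto (windowDivisor b) atTop atTop := by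
  have h1 : Tendsto (Nat.log 2) atTop atTop :=
    tendsto_atTop_atTop.2 fun k => ⟨2 ^ k, fun n hn =>
      Nat.le_log_of_pow_le (by norm_num) hn⟩
  have h2 := h1.comp hlim
  refine tendsto_atTop.2 fun k => ?_
  filter_upwards [h2.eventually_ge_atTop k, eventually_ge_atTop k] with n hn hn'
  simp only [Function.comp] at hn
  unfold windowDivisor
  omega

theorem tendsto_windowSize_div {b : ℕ → ℕ} (hb : ∀ n, 2 ≤ b n) (hlim : Tendsto b atTop atTop) :
    Tendsto (fun n => (windowSize b n : ℝ) / b n) atTop (𝓝 0) := by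
  have h := tendsto_inv_atTop_zero.comp
    ((tendsto_natCast_atTop_atTop (R := ℝ)).comp (tendsto_windowDivisor hlim))
  refine squeeze_zero (fun n => by positivity) (fun n => ?_) h
  have hk : (0 : ℝ) < windowDivisor b n := by
    exact_mod_cast (by have := two_le_windowDivisor hb n; omega : 0 < windowDivisor b n)
  have hbn : (0 : ℝ) < b n := by exact_mod_cast (by have := hb n; omega : 0 < b n)
  simp only [Function.comp]
  rw [div_le_iff₀ hbn, inv_mul_eq_div]
  exact Nat.cast_div_le

theorem eventually_log_mul_rpow_le {r : ℝ} (hr : r < 1) :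
    ∀ᶠ x : ℝ in atTop, 4 * (Real.log x / Real.log 2 + 1) * x ^ r ≤ x := by
  have h1 := isLittleO_log_rpow_atTop (r := 1 - r) (by linarith)
  have hl : 0 < Real.log 2 := Real.log_pos (by norm_num)
  filter_upwards [h1.bound (c := Real.log 2 / 8) (by positivity), eventually_gt_atTop 1,
    (tendsto_rpow_atTop (y := 1 - r) (by linarith)).eventually_ge_atTop 8] with x hx hx1 hx8
  have hx0 : 0 < x := by linarith
  rw [Real.norm_of_nonneg (Real.log_nonneg hx1.le), Real.norm_of_nonneg (by positivity)] at hx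
  have h2 : Real.log x / Real.log 2 ≤ x ^ (1 - r) / 8 := by
    rw [div_le_iff₀ hl]; linarith
  calc 4 * (Real.log x / Real.log 2 + 1) * x ^ r
      ≤ x ^ (1 - r) * x ^ r := by gcongr; linarith
    _ = x := by rw [← Real.rpow_add hx0]; simp

/-- Both terms of the minimum in `windowDivisor` matter. The logarithm makes the loss negligible
against `b n ^ (1 - r)`, so eventually each place gains a factor `m n / b n ^ r ≥ 2`. The cap `n +
1` bounds `b n / m n` by `2 * (n + 2)` however fast `b` grows, and the factors 2 gained earlier
absorb this linear growth. -/
theorem largeWindows_windowSize {b : ℕ → ℕ} (hb : ∀ n, 2 ≤ b n) (hlim : Tendsto b atTop atTop)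
    {r : ℝ} (hr0 : 0 < r) (hr1 : r < 1) : LargeWindows b (windowSize b) r := by
  have hbpos : ∀ n, (0 : ℝ) < b n := fun n => by
    exact_mod_cast (by have := hb n; omega : 0 < b n)
  have hmpos : ∀ n, (0 : ℝ) < windowSize b n := fun n => by
    exact_mod_cast one_le_windowSize hb n
  have hQ : ∀ n, (0 : ℝ) < scale b n := fun n => by
    exact_mod_cast scale_pos (fun n => by have := hb n; omega) n
  have hP : ∀ n, (0 : ℝ) < scale (windowSize b) n := fun n => by
    exact_mod_cast scale_pos (one_le_windowSize hb) n
  have hratio : ∀ᶠ n in atTop, 2 * (b n : ℝ) ^ r ≤ windowSize b n := by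
    filter_upwards [(tendsto_natCast_atTop_atTop.comp hlim).eventually
      (eventually_log_mul_rpow_le hr1)] with n hn
    simp only [Function.comp] at hn
    have h1 := div_windowSize_le hb n
    rw [div_le_iff₀ (hmpos n)] at h1
    have hk : (windowDivisor b n : ℝ) ≤ Real.log (b n) / Real.log 2 + 1 := by
      have h2 : windowDivisor b n ≤ Nat.log 2 (b n) + 1 := by unfold windowDivisor; omega
      have h3 : (Nat.log 2 (b n) : ℝ) ≤ Real.log (b n) / Real.log 2 := by
        simpa [Real.logb] using Real.natLog_le_logb (b n) 2
      have h4 : (windowDivisor b n : ℝ) ≤ Nat.log 2 (b n) + 1 := by exact_mod_cast h2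
      linarith
    have hkpos : (0 : ℝ) < windowDivisor b n := by
      exact_mod_cast (by have := two_le_windowDivisor hb n; omega : 0 < windowDivisor b n)
    have h5 : 4 * (windowDivisor b n : ℝ) * (b n : ℝ) ^ r ≤ 2 * windowDivisor b n * windowSize b n :=
      le_trans (by gcongr) (hn.trans h1)
    nlinarith
  obtain ⟨C, hC⟩ := exists_bound_of_eventually_antitone
    (R := fun n => (scale b n : ℝ) ^ r * (2 * (n + 2)) / scale (windowSize b) n) (by
      filter_upwards [hratio] with n hn
      rw [div_le_div_iff₀ (hP _) (hP _), scale_succ, scale_succ]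
      push_cast
      rw [Real.mul_rpow (hQ n).le (hbpos n).le]
      have h1 : (b n : ℝ) ^ r * (n + 1 + 2) ≤ (n + 2) * windowSize b n := by
        have : (n : ℝ) + 1 + 2 ≤ 2 * (n + 2) := by linarith [Nat.cast_nonneg (α := ℝ) n]
        calc (b n : ℝ) ^ r * (n + 1 + 2) ≤ (b n : ℝ) ^ r * (2 * (n + 2)) := by gcongr
          _ = (n + 2) * (2 * (b n : ℝ) ^ r) := by ring
          _ ≤ _ := by gcongr
      have h2 : 0 ≤ 2 * (scale b n : ℝ) ^ r * scale (windowSize b) n := by positivity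
      calc _ = 2 * (scale b n : ℝ) ^ r * scale (windowSize b) n
                * ((b n : ℝ) ^ r * (n + 1 + 2)) := by ring
        _ ≤ 2 * (scale b n : ℝ) ^ r * scale (windowSize b) n * ((n + 2) * windowSize b n) := by
            gcongr
        _ = _ := by ring)
  refine ⟨C, fun n => ?_⟩
  have h1 := hC n
  rw [div_le_iff₀ (hP n)] at h1
  refine le_trans ?_ h1
  gcongr
  have h2 : 1 ≤ (b n : ℝ) / windowSize b n := by
    rw [one_le_div (hmpos n)]
    exact_mod_cast (by have := two_mul_windowSize_le hb n; omega : windowSize b n ≤ b n)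
  have h3 : (windowDivisor b n : ℝ) ≤ n + 2 := by
    exact_mod_cast (by unfold windowDivisor; omega : windowDivisor b n ≤ n + 2)
  calc ((b n : ℝ) / windowSize b n) ^ r ≤ (b n : ℝ) / windowSize b n := by
        simpa using Real.rpow_le_rpow_of_exponent_le h2 hr1.le
    _ ≤ 2 * windowDivisor b n := div_windowSize_le hb n
    _ ≤ 2 * (n + 2) := by gcongr

/-! ### A uniformly distributed sequence -/

theorem A_zero (I : Set ℝ) (ω : ℕ → ℝ) : A 0 I ω = 0 := by simp [A]

open Classical in
theorem A_succ (n : ℕ) (I : Set ℝ) (ω : ℕ → ℝ) :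
    A (n + 1) I ω = A n I ω + if ω n ∈ I then 1 else 0 := by
  unfold A
  rw [Finset.range_add_one, Finset.filter_insert]
  split_ifs
  · rw [Finset.card_insert_of_notMem (by simp)]
  · rfl

theorem A_add (m k : ℕ) (I : Set ℝ) (ω : ℕ → ℝ) :
    A (m + k) I ω = A m I ω + A k I (fun j => ω (m + j)) := by
  induction k with
  | zero => simp [A_zero]
  | succ k ih => rw [← add_assoc, A_succ, A_succ, ih, add_assoc]

theorem A_mono (I : Set ℝ) (ω : ℕ → ℝ) : Monotone fun n => A n I ω :=
  monotone_nat_of_le_succ fun n => by rw [A_succ]; exact Nat.le_add_right _ _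

/-- The concatenation of the blocks `0, 1 / K, …, (K - 1) / K` for `K = 1, 3, 5, …`. -/
noncomputable def blockSeq (n : ℕ) : ℝ := ((n - n.sqrt ^ 2 : ℕ) : ℝ) / ((2 * n.sqrt + 1 : ℕ) : ℝ)

theorem blockSeq_mem (n : ℕ) : blockSeq n ∈ Set.Ico (0 : ℝ) 1 := by
  refine ⟨by unfold blockSeq; positivity, ?_⟩
  unfold blockSeq
  rw [div_lt_one (by positivity)]
  have := Nat.sqrt_le_add n
  have h2 : n.sqrt ^ 2 = n.sqrt * n.sqrt := sq _
  exact_mod_cast (by omega : n - n.sqrt ^ 2 < 2 * n.sqrt + 1)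

theorem blockSeq_sq_add {N j : ℕ} (hj : j < 2 * N + 1) :
    blockSeq (N ^ 2 + j) = (j : ℝ) / (2 * N + 1 : ℕ) := by
  have h : (N ^ 2 + j).sqrt = N := by
    rw [sq]; exact Nat.sqrt_add_eq N (by omega)
  rw [blockSeq, h, Nat.add_sub_cancel_left]

theorem A_blockSeq_sq_succ {t : ℝ} (ht : t ≤ 1) (N : ℕ) :
    A ((N + 1) ^ 2) (Set.Iio t) blockSeq
      = A (N ^ 2) (Set.Iio t) blockSeq + ⌈t * (2 * N + 1 : ℕ)⌉₊ := by
  have h1 : (N + 1) ^ 2 = N ^ 2 + (2 * N + 1) := by ring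
  rw [h1, A_add]
  congr 1
  have h2 : ⌈t * (2 * N + 1 : ℕ)⌉₊ ≤ 2 * N + 1 := by
    rw [Nat.ceil_le]
    exact mul_le_of_le_one_left (Nat.cast_nonneg _) ht
  unfold A
  conv_rhs => rw [← Finset.card_range ⌈t * (2 * N + 1 : ℕ)⌉₊]
  congr 1
  ext j
  simp only [Finset.mem_filter, Finset.mem_range, Set.mem_Iio]
  have hK : (0 : ℝ) < (2 * N + 1 : ℕ) := by positivity
  constructor
  · rintro ⟨hj, hlt⟩
    rw [blockSeq_sq_add hj, div_lt_iff₀ hK] at hlt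
    exact Nat.lt_ceil.2 hlt
  · intro hj
    have hj' : j < 2 * N + 1 := hj.trans_le h2
    refine ⟨hj', ?_⟩
    rw [blockSeq_sq_add hj', div_lt_iff₀ hK]
    exact Nat.lt_ceil.1 hj

/-- Each complete block contributes an error below 1, from rounding up. -/
theorem abs_A_blockSeq_sq_sub_le {t : ℝ} (ht : t ∈ Set.Icc (0 : ℝ) 1) (N : ℕ) :
    |(A (N ^ 2) (Set.Iio t) blockSeq : ℝ) - t * N ^ 2| ≤ N := by
  induction N with
  | zero => simp [A_zero]
  | succ N ih =>
    rw [A_blockSeq_sq_succ ht.2]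
    have h0 : 0 ≤ t * (2 * N + 1 : ℕ) := mul_nonneg ht.1 (Nat.cast_nonneg _)
    have h1 := Nat.le_ceil (t * (2 * N + 1 : ℕ))
    have h2 := Nat.ceil_lt_add_one h0
    push_cast at h1 h2 ⊢
    rw [abs_le] at ih ⊢
    constructor <;> nlinarith [ih.1, ih.2]

theorem tendsto_A_blockSeq {t : ℝ} (ht : t ∈ Set.Icc (0 : ℝ) 1) :
    Tendsto (fun n : ℕ => (A n (Set.Iio t) blockSeq : ℝ) / n) atTop (𝓝 t) := by
  have hlim : Tendsto (fun n : ℕ => 5 / √(n : ℝ)) atTop (𝓝 0) :=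
    (Real.tendsto_sqrt_atTop.comp tendsto_natCast_atTop_atTop).const_div_atTop 5
  rw [tendsto_iff_dist_tendsto_zero]
  refine squeeze_zero' (.of_forall fun _ => dist_nonneg) ?_ hlim
  filter_upwards [eventually_ge_atTop 1] with n hn
  have hn0 : (0 : ℝ) < n := by exact_mod_cast hn
  set N := n.sqrt with hN
  have hN1 : (1 : ℝ) ≤ N := by exact_mod_cast Nat.sqrt_pos.2 hn
  have hlo : N ^ 2 ≤ n := by rw [sq]; exact Nat.sqrt_le n
  have hhi : n ≤ N ^ 2 + 2 * N := by rw [sq, hN]; have := Nat.sqrt_le_add n; omega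
  have hA1 : A (N ^ 2) (Set.Iio t) blockSeq ≤ A n (Set.Iio t) blockSeq := A_mono _ _ hlo
  have hA2 : A n (Set.Iio t) blockSeq ≤ A ((N + 1) ^ 2) (Set.Iio t) blockSeq :=
    A_mono _ _ (by nlinarith)
  have h1 := abs_le.1 (abs_A_blockSeq_sq_sub_le ht N)
  have h2 := abs_le.1 (abs_A_blockSeq_sq_sub_le ht (N + 1))
  have hlo' : (N : ℝ) ^ 2 ≤ n := by exact_mod_cast hlo
  have hhi' : (n : ℝ) ≤ N ^ 2 + 2 * N := by exact_mod_cast hhi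
  have hA1' : (A (N ^ 2) (Set.Iio t) blockSeq : ℝ) ≤ A n (Set.Iio t) blockSeq := by
    exact_mod_cast hA1
  have hA2' : (A n (Set.Iio t) blockSeq : ℝ) ≤ A ((N + 1) ^ 2) (Set.Iio t) blockSeq := by
    exact_mod_cast hA2
  push_cast at h2
  -- The incomplete block has at most `2 * N` terms, so the total error is of order `√n`.
  have hmain : |(A n (Set.Iio t) blockSeq : ℝ) - t * n| ≤ 5 * N := by
    have e1 : t * (N : ℝ) ^ 2 ≤ t * n := mul_le_mul_of_nonneg_left hlo' ht.1
    have e2 : t * n ≤ t * (N : ℝ) ^ 2 + 2 * N := by nlinarith [ht.1, ht.2]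
    have e3 : t * ((N : ℝ) + 1) ^ 2 ≤ t * (N : ℝ) ^ 2 + 2 * N + 1 := by nlinarith [ht.1, ht.2]
    rw [abs_le]
    constructor <;> linarith [h1.1, h2.2]
  have hNs : (N : ℝ) ≤ √n := Real.nat_sqrt_le_real_sqrt
  have hs : √(n : ℝ) * √n = n := Real.mul_self_sqrt hn0.le
  have hspos : 0 < √(n : ℝ) := Real.sqrt_pos.2 hn0
  rw [Real.dist_eq, div_sub' hn0.ne', abs_div, abs_of_pos hn0, div_le_div_iff₀ hn0 hspos]
  calc |(A n (Set.Iio t) blockSeq : ℝ) - n * t| * √n ≤ 5 * √n * √n := by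
        rw [mul_comm (n : ℝ) t]; gcongr; linarith
    _ = 5 * n := by rw [mul_assoc, hs]

/-! ### From uniform distribution to the distribution `f` -/

/-- `g` separates the points where `f ≤ u` from those where `u < f`. -/
theorem IsADF.exists_threshold {f : ℝ → ℝ} (hf : IsADF f) {u : ℝ} (hu : u ∈ Set.Ico (0 : ℝ) 1) :
    ∃ g ∈ Set.Icc (0 : ℝ) 1, (∀ t ∈ Set.Icc (0 : ℝ) 1, t < g → f t ≤ u) ∧
      ∀ t ∈ Set.Icc (0 : ℝ) 1, g < t → u < f t := by
  set S := {t | t ∈ Set.Icc (0 : ℝ) 1 ∧ f t ≤ u} with hS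
  have h0 : (0 : ℝ) ∈ S := ⟨by simp, by rw [hf.map_zero]; exact hu.1⟩
  have hbdd : BddAbove S := ⟨1, fun t ht => ht.1.2⟩
  refine ⟨sSup S, ⟨le_csSup hbdd h0, csSup_le ⟨0, h0⟩ fun t ht => ht.1.2⟩, fun t ht htg => ?_,
    fun t ht htg => ?_⟩
  · obtain ⟨s, hs, hts⟩ := exists_lt_of_lt_csSup ⟨0, h0⟩ htg
    exact (hf.monotoneOn ht hs.1 hts.le).trans hs.2
  · by_contra! hcon
    exact absurd (le_csSup hbdd ⟨ht, hcon⟩) (not_le.2 htg)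

open Classical in
theorem A_add_A_le {ω₁ ω₂ ω₃ ω₄ : ℕ → ℝ} {I₁ I₂ I₃ I₄ : Set ℝ} {N : ℕ}
    (h : ∀ n ≥ N, (if ω₁ n ∈ I₁ then 1 else 0) + (if ω₂ n ∈ I₂ then 1 else 0) ≤
      (if ω₃ n ∈ I₃ then 1 else 0) + (if ω₄ n ∈ I₄ then 1 else 0)) (n : ℕ) :
    A n I₁ ω₁ + A n I₂ ω₂ ≤ A n I₃ ω₃ + A n I₄ ω₄ + 2 * N := by
  suffices A n I₁ ω₁ + A n I₂ ω₂ ≤ A n I₃ ω₃ + A n I₄ ω₄ + 2 * min n N by omega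
  induction n with
  | zero => simp [A_zero]
  | succ n ih =>
    simp only [A_succ]
    rcases le_or_gt N n with hn | hn
    · have := h n hn
      omega
    · split_ifs <;> omega

/-- `ω` lies within `ε` of the threshold `g`, and strictly below it exactly when `u < f g`, except
possibly near the endpoints of the unit interval. -/
def IsNear (f : ℝ → ℝ) (u g ε ω : ℝ) : Prop :=
  (u < f g → (ω < g ∨ ω < ε) ∧ g - ε ≤ ω) ∧ (f g ≤ u → (g ≤ ω ∨ 1 - ε ≤ ω) ∧ ω ≤ g + ε)

section HasADF

variable {f : ℝ → ℝ} {u ω ε g : ℕ → ℝ}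

-- With `L` the right limit of `f` at `t`, choose `s > t` with `f s < L + δ`. For large `n`, `ω n <
-- t` forces `u n < f t` or `L ≤ u n < f s`, and the second range has frequency below `δ`. Values of
-- `u n` inside the jump `[f t, L)` cause no error.
open Classical in
theorem IsADF.eventually_A_lt (hf : IsADF f)
    (hu : ∀ t ∈ Set.Icc (0 : ℝ) 1, Tendsto (fun n : ℕ => (A n (Set.Iio t) u : ℝ) / n) atTop (𝓝 t))
    (hε : Tendsto ε atTop (𝓝 0)) (hg : ∀ n, g n ∈ Set.Icc (0 : ℝ) 1)
    (hg1 : ∀ n, ∀ t ∈ Set.Icc (0 : ℝ) 1, t < g n → f t ≤ u n)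
    (hg2 : ∀ n, ∀ t ∈ Set.Icc (0 : ℝ) 1, g n < t → u n < f t)
    (hω : ∀ n, IsNear f (u n) (g n) (ε n) (ω n)) {t : ℝ} (ht : t ∈ Set.Ioo (0 : ℝ) 1) {δ : ℝ}
    (hδ : 0 < δ) : ∀ᶠ n : ℕ in atTop, (A n (Set.Ico 0 t) ω : ℝ) / n < f t + δ := by
  have htI : t ∈ Set.Icc (0 : ℝ) 1 := ⟨ht.1.le, ht.2.le⟩
  set S := f '' Set.Ioc t 1 with hS
  have hI : ∀ s ∈ Set.Ioc t 1, s ∈ Set.Icc (0 : ℝ) 1 := fun s hs => ⟨ht.1.le.trans hs.1.le, hs.2⟩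
  have hlb : f t ∈ lowerBounds S := by
    rintro _ ⟨s, hs, rfl⟩; exact hf.monotoneOn htI (hI s hs) hs.1.le
  have hne : S.Nonempty := ⟨f 1, 1, ⟨ht.2, le_rfl⟩, rfl⟩
  obtain ⟨_, ⟨s, hs, rfl⟩, hsδ⟩ := exists_lt_of_csInf_lt hne (lt_add_of_pos_right (sInf S) hδ)
  set L := sInf S
  have hL : ∀ s ∈ Set.Ioc t 1, L ≤ f s := fun s hs => csInf_le ⟨f t, hlb⟩ ⟨s, hs, rfl⟩
  have htL : f t ≤ L := le_csInf hne hlb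
  have hft := hf.mapsTo htI
  have hfs := hf.mapsTo (hI s hs)
  have hev : ∀ᶠ n in atTop, ε n < min (1 - t) (s - t) :=
    hε.eventually_lt_const (lt_min (by linarith [ht.2]) (by linarith [hs.1]))
  obtain ⟨N, hN⟩ := eventually_atTop.1 hev
  have hcount := A_add_A_le (ω₁ := ω) (I₁ := Set.Ico 0 t) (ω₂ := u) (I₂ := Set.Iio L) (ω₃ := u)
    (I₃ := Set.Iio (f t)) (ω₄ := u) (I₄ := Set.Iio (f s)) (N := N) fun n hn => by
    obtain ⟨he1, he2⟩ := lt_min_iff.1 (hN n hn)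
    have hkey : ω n < t → f t ≤ u n → L ≤ u n ∧ u n < f s := fun hlt hle => by
      have htg : t ≤ g n := by
        by_contra! hcon; exact absurd (hg2 n t htI hcon) (not_lt.2 hle)
      rcases lt_or_ge (u n) (f (g n)) with hc | hc
      · have h1 := ((hω n).1 hc).2
        -- Strictness leaves room for a midpoint between `t` and `g n`, where `f` is at least `L`
        -- and at most `u n`.
        have htg' : t < g n := lt_of_le_of_ne htg fun h => by rw [← h] at hc; linarith
        refine ⟨(hL ((t + g n) / 2) ⟨by linarith, by linarith [(hg n).2]⟩).trans
          (hg1 n _ ⟨by linarith [ht.1], by linarith [(hg n).2]⟩ (by linarith)),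
          hg2 n s (hI s hs) (by linarith)⟩
      · rcases ((hω n).2 hc).1 with h1 | h1 <;> linarith
    have hLs : L ≤ f s := hL s hs
    by_cases h1 : ω n < t <;> by_cases h2 : u n < L <;> by_cases h3 : u n < f t <;>
      by_cases h4 : u n < f s <;> simp only [Set.mem_Ico, Set.mem_Iio, h1, h2, h3, h4, and_true, and_false,
        if_true, if_false] <;>
      first
      | omega
      | (split_ifs <;> omega)
      | (exfalso; linarith)
      | (exfalso; obtain ⟨h5, h6⟩ := hkey h1 (not_lt.1 h3); linarith)
  have hlim : Tendsto (fun n : ℕ => (A n (Set.Iio (f t)) u : ℝ) / n + (A n (Set.Iio (f s)) u : ℝ) / n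
      - (A n (Set.Iio L) u : ℝ) / n + (2 * N : ℕ) / n) atTop (𝓝 (f t + f s - L + 0)) :=
    (((hu _ hft).add (hu _ hfs)).sub (hu L ⟨hft.1.trans htL, (hL s hs).trans hfs.2⟩)).add
      (tendsto_const_div_atTop_nhds_zero_nat _)
  filter_upwards [hlim.eventually_lt_const (show f t + f s - L + 0 < f t + δ by linarith)] with n hn
  refine lt_of_le_of_lt ?_ hn
  rw [← add_div, ← sub_div, ← add_div]
  have h : (A n (Set.Ico 0 t) ω : ℝ) + A n (Set.Iio L) u
      ≤ A n (Set.Iio (f t)) u + A n (Set.Iio (f s)) u + (2 * N : ℕ) := by exact_mod_cast hcount n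
  gcongr
  linarith

-- Mirror image, with the left limit `U` of `f` at `t` and `s < t`: `u n < f t` forces `ω n < t`
-- unless `f s ≤ u n < U`.
open Classical in
theorem IsADF.eventually_lt_A (hf : IsADF f)
    (hu : ∀ t ∈ Set.Icc (0 : ℝ) 1, Tendsto (fun n : ℕ => (A n (Set.Iio t) u : ℝ) / n) atTop (𝓝 t))
    (hε : Tendsto ε atTop (𝓝 0)) (hω0 : ∀ n, 0 ≤ ω n) (hg : ∀ n, g n ∈ Set.Icc (0 : ℝ) 1)
    (hg1 : ∀ n, ∀ t ∈ Set.Icc (0 : ℝ) 1, t < g n → f t ≤ u n)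
    (hg2 : ∀ n, ∀ t ∈ Set.Icc (0 : ℝ) 1, g n < t → u n < f t)
    (hω : ∀ n, IsNear f (u n) (g n) (ε n) (ω n)) {t : ℝ} (ht : t ∈ Set.Ioo (0 : ℝ) 1) {δ : ℝ}
    (hδ : 0 < δ) : ∀ᶠ n : ℕ in atTop, f t - δ < (A n (Set.Ico 0 t) ω : ℝ) / n := by
  have htI : t ∈ Set.Icc (0 : ℝ) 1 := ⟨ht.1.le, ht.2.le⟩
  set S := f '' Set.Ico 0 t with hS
  have hI : ∀ s ∈ Set.Ico 0 t, s ∈ Set.Icc (0 : ℝ) 1 := fun s hs => ⟨hs.1, hs.2.le.trans ht.2.le⟩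
  have hub : f t ∈ upperBounds S := by
    rintro _ ⟨s, hs, rfl⟩; exact hf.monotoneOn (hI s hs) htI hs.2.le
  have hne : S.Nonempty := ⟨f 0, 0, ⟨le_rfl, ht.1⟩, rfl⟩
  obtain ⟨_, ⟨s, hs, rfl⟩, hsδ⟩ := exists_lt_of_lt_csSup hne (sub_lt_self (sSup S) hδ)
  set U := sSup S
  have hU : ∀ s ∈ Set.Ico 0 t, f s ≤ U := fun s hs => le_csSup ⟨f t, hub⟩ ⟨s, hs, rfl⟩
  have hUt : U ≤ f t := csSup_le hne hub
  have hft := hf.mapsTo htI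
  have hfs := hf.mapsTo (hI s hs)
  have hev : ∀ᶠ n in atTop, ε n < min t (t - s) :=
    hε.eventually_lt_const (lt_min ht.1 (by linarith [hs.2]))
  obtain ⟨N, hN⟩ := eventually_atTop.1 hev
  have hcount := A_add_A_le (ω₁ := u) (I₁ := Set.Iio (f t)) (ω₂ := u) (I₂ := Set.Iio (f s)) (ω₃ := ω)
    (I₃ := Set.Ico 0 t) (ω₄ := u) (I₄ := Set.Iio U) (N := N) fun n hn => by
    obtain ⟨he1, he2⟩ := lt_min_iff.1 (hN n hn)
    have hkey : u n < f t → (u n < f s ∨ U ≤ u n) → ω n < t := fun hlt hor => by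
      have hgt : g n ≤ t := by
        by_contra! hcon; exact absurd (hg1 n t htI hcon) (not_le.2 hlt)
      rcases lt_or_ge (u n) (f (g n)) with hc | hc
      · rcases ((hω n).1 hc).1 with h1 | h1 <;> linarith
      · have h1 := ((hω n).2 hc).2
        have hgt' : g n < t := lt_of_le_of_ne hgt fun h => by rw [h] at hc; linarith
        rcases hor with h2 | h2
        · have hgs : g n ≤ s := by
            by_contra! hcon; exact absurd (hg1 n s (hI s hs) hcon) (not_le.2 h2)
          linarith
        · have h3 := hg2 n ((g n + t) / 2) ⟨by linarith [(hg n).1, ht.1], by linarith [ht.2]⟩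
            (by linarith)
          have h4 := hU ((g n + t) / 2) ⟨by linarith [(hg n).1, ht.1], by linarith⟩
          linarith
    have hsU : f s ≤ U := hU s hs
    by_cases h1 : ω n < t <;> by_cases h2 : u n < U <;> by_cases h3 : u n < f t <;>
      by_cases h4 : u n < f s <;> simp only [Set.mem_Ico, Set.mem_Iio, h1, h2, h3, h4, hω0 n, and_true,
        and_false, if_true, if_false] <;>
      first
      | omega
      | (exfalso; linarith)
      | (exfalso; exact h1 (hkey h3 (.inl h4)))
      | (exfalso; exact h1 (hkey h3 (.inr (not_lt.1 h2))))
  have hlim : Tendsto (fun n : ℕ => (A n (Set.Iio (f t)) u : ℝ) / n + (A n (Set.Iio (f s)) u : ℝ) / n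
      - (A n (Set.Iio U) u : ℝ) / n - (2 * N : ℕ) / n) atTop (𝓝 (f t + f s - U - 0)) :=
    (((hu _ hft).add (hu _ hfs)).sub (hu U ⟨hfs.1.trans (hU s hs), hUt.trans hft.2⟩)).sub
      (tendsto_const_div_atTop_nhds_zero_nat _)
  filter_upwards [hlim.eventually_const_lt (show f t - δ < f t + f s - U - 0 by linarith)] with n hn
  refine lt_of_lt_of_le hn ?_
  rw [← add_div, ← sub_div, ← sub_div]
  have h : (A n (Set.Iio (f t)) u : ℝ) + A n (Set.Iio (f s)) u
      ≤ A n (Set.Ico 0 t) ω + A n (Set.Iio U) u + (2 * N : ℕ) := by exact_mod_cast hcount n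
  gcongr
  linarith

theorem IsADF.hasADF_of_isNear (hf : IsADF f)
    (hu : ∀ t ∈ Set.Icc (0 : ℝ) 1, Tendsto (fun n : ℕ => (A n (Set.Iio t) u : ℝ) / n) atTop (𝓝 t))
    (hε : Tendsto ε atTop (𝓝 0)) (hωI : ∀ n, ω n ∈ Set.Ico (0 : ℝ) 1)
    (hg : ∀ n, g n ∈ Set.Icc (0 : ℝ) 1)
    (hg1 : ∀ n, ∀ t ∈ Set.Icc (0 : ℝ) 1, t < g n → f t ≤ u n)
    (hg2 : ∀ n, ∀ t ∈ Set.Icc (0 : ℝ) 1, g n < t → u n < f t)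
    (hω : ∀ n, IsNear f (u n) (g n) (ε n) (ω n)) : HasADF ω f := by
  intro t ht
  rcases ht.1.eq_or_lt with rfl | h0
  · simp [A, hf.map_zero]
  rcases ht.2.eq_or_lt with rfl | h1
  · rw [hf.map_one]
    refine tendsto_const_nhds.congr' ?_
    filter_upwards [eventually_ge_atTop 1] with n hn
    have : A n (Set.Ico 0 1) ω = n := by
      simp [A, -Set.mem_Ico, hωI]
    rw [this, div_self]
    positivity
  refine tendsto_order.2 ⟨fun c hc => ?_, fun c hc => ?_⟩
  · have := hf.eventually_lt_A hu hε (fun n => (hωI n).1) hg hg1 hg2 hω ⟨h0, h1⟩ (sub_pos.2 hc)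
    simpa using this
  · have := hf.eventually_A_lt hu hε hg hg1 hg2 hω ⟨h0, h1⟩ (sub_pos.2 hc)
    simpa using this

end HasADF

/-! ### Placing the windows -/

theorem exists_window_below {b m : ℕ} (hm : m + 1 ≤ b) {g : ℝ} (hg : g ∈ Set.Icc (0 : ℝ) 1) :
    ∃ a, a + m + 1 ≤ b ∧ ∀ w ∈ Set.Ico ((a : ℝ) / b) ((a + m : ℝ) / b),
      (w < g ∨ w < (m + 2) / b) ∧ g - (m + 2) / b ≤ w := by
  have hb : (0 : ℝ) < b := by exact_mod_cast (by omega : 0 < b)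
  have hgb : 0 ≤ g * b := mul_nonneg hg.1 hb.le
  have hfl : ⌊g * b⌋₊ ≤ b := by
    have : ⌊g * b⌋₊ ≤ ⌊(b : ℝ)⌋₊ := Nat.floor_mono (mul_le_of_le_one_left hb.le hg.2)
    simpa using this
  have h1 := Nat.floor_le hgb
  have h2 := Nat.lt_floor_add_one (g * b)
  -- The extra 1 keeps the maximal digit unused. If the subtraction truncates, `g` is too close to 0
  -- and the window starts at 0; this is the alternative `w < (m + 2) / b`.
  refine ⟨⌊g * b⌋₊ - m - 1, by omega, fun w hw => ?_⟩
  rw [Set.mem_Ico, div_le_iff₀ hb, lt_div_iff₀ hb] at hw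
  rw [lt_div_iff₀ hb, sub_le_iff_le_add, ← sub_le_iff_le_add', le_div_iff₀ hb, sub_mul]
  rcases le_total (m + 1) ⌊g * b⌋₊ with hc | hc
  · have ha : ((⌊g * b⌋₊ - m - 1 : ℕ) : ℝ) = ⌊g * b⌋₊ - m - 1 := by
      rw [Nat.sub_sub, Nat.cast_sub hc]; push_cast; ring
    rw [ha] at hw
    exact ⟨.inl (lt_of_mul_lt_mul_right (by linarith) hb.le), by linarith⟩
  · have ha : ⌊g * b⌋₊ - m - 1 = 0 := by omega
    have hc' : (⌊g * b⌋₊ : ℝ) ≤ m + 1 := by exact_mod_cast hc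
    rw [ha] at hw
    push_cast at hw
    exact ⟨.inr (by linarith), by linarith⟩

theorem exists_window_above {b m : ℕ} (hm : m + 1 ≤ b) {g : ℝ} (hg : g ∈ Set.Icc (0 : ℝ) 1) :
    ∃ a, a + m + 1 ≤ b ∧ ∀ w ∈ Set.Ico ((a : ℝ) / b) ((a + m : ℝ) / b),
      (g ≤ w ∨ 1 - (m + 2) / b ≤ w) ∧ w ≤ g + (m + 2) / b := by
  have hb : (0 : ℝ) < b := by exact_mod_cast (by omega : 0 < b)
  have hgb : 0 ≤ g * b := mul_nonneg hg.1 hb.le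
  have h1 := Nat.le_ceil (g * b)
  have h2 := Nat.ceil_lt_add_one hgb
  -- The cap keeps the window off the maximal digit; when it is active, `w` is near 1, giving the
  -- second alternative.
  refine ⟨min ⌈g * b⌉₊ (b - m - 1), by omega, fun w hw => ?_⟩
  rw [Set.mem_Ico, div_le_iff₀ hb, lt_div_iff₀ hb] at hw
  have hmin : ((min ⌈g * b⌉₊ (b - m - 1) : ℕ) : ℝ) ≤ ⌈g * b⌉₊ := by exact_mod_cast min_le_left _ _
  refine ⟨?_, ?_⟩
  · rcases le_total ⌈g * b⌉₊ (b - m - 1) with hc | hc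
    · rw [min_eq_left hc] at hw
      exact .inl (le_of_mul_le_mul_right (by linarith) hb)
    · have ha : ((b - m - 1 : ℕ) : ℝ) = b - m - 1 := by
        rw [Nat.sub_sub, Nat.cast_sub hm]; push_cast; ring
      rw [min_eq_right hc, ha] at hw
      right
      rw [sub_le_iff_le_add, ← sub_le_iff_le_add', le_div_iff₀ hb, sub_mul]
      linarith
  · rw [← sub_le_iff_le_add', le_div_iff₀ hb, sub_mul]
    linarith

theorem exists_window_isNear {b m : ℕ} (hm : m + 1 ≤ b) (f : ℝ → ℝ) (u : ℝ) {g : ℝ}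
    (hg : g ∈ Set.Icc (0 : ℝ) 1) :
    ∃ a, a + m + 1 ≤ b ∧ ∀ w ∈ Set.Ico ((a : ℝ) / b) ((a + m : ℝ) / b),
      IsNear f u g ((m + 2) / b) w := by
  rcases lt_or_ge u (f g) with hc | hc
  · obtain ⟨a, ha, hw⟩ := exists_window_below hm hg
    exact ⟨a, ha, fun w h => ⟨fun _ => hw w h, fun h' => absurd hc (not_lt.2 h')⟩⟩
  · obtain ⟨a, ha, hw⟩ := exists_window_above hm hg
    exact ⟨a, ha, fun w h => ⟨fun h' => absurd hc (not_le.2 h'), fun _ => hw w h⟩⟩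

theorem IsADF.exists_windowSet_subset {f : ℝ → ℝ} (hf : IsADF f) {b m : ℕ → ℕ}
    (hm : ∀ n, m n + 1 ≤ b n) (hlim : Tendsto b atTop atTop)
    (hmb : Tendsto (fun n => (m n : ℝ) / b n) atTop (𝓝 0)) :
    ∃ a : ℕ → ℕ, (∀ n, a n + m n + 1 ≤ b n) ∧
      windowSet b a m ⊆ {x | HasADF (fun n => Int.fract ((scale b n : ℝ) * x)) f} := by
  choose g hg hg1 hg2 using fun n => hf.exists_threshold (blockSeq_mem n)
  choose a ha hw using fun n => exists_window_isNear (hm n) f (blockSeq n) (hg n)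
  have hε : Tendsto (fun n => ((m n : ℝ) + 2) / b n) atTop (𝓝 0) := by
    have h1 : Tendsto (fun n => (2 : ℝ) / b n) atTop (𝓝 0) :=
      (tendsto_natCast_atTop_atTop.comp hlim).const_div_atTop 2
    simpa [add_div] using hmb.add h1
  exact ⟨a, ha, fun x hx => hf.hasADF_of_isNear (fun t ht => tendsto_A_blockSeq ht) hε
    (fun n => ⟨Int.fract_nonneg _, Int.fract_lt_one _⟩) hg hg1 hg2 fun n => hw n _ (hx n)⟩

end CantorSeries

theorem mainTheorem4 (q : ℕ → ℕ) (hq : CantorSeries.IsBasicSequence q)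
    (hlim : CantorSeries.InfiniteInLimit q) (f : ℝ → ℝ) (hf : CantorSeries.IsADF f) :
    dimH {x : ℝ | CantorSeries.HasADF (fun n => CantorSeries.T q n x) f} = 1 := by
  refine le_antisymm ((dimH_mono (Set.subset_univ _)).trans Real.dimH_univ.le) ?_
  simp only [CantorSeries.T_eq_fract_scale]
  set b : ℕ → ℕ := fun n => q (n + 1) with hb_def
  have hb : ∀ n, 2 ≤ b n := fun n => hq (n + 1) (by omega)
  have hblim : Tendsto b atTop atTop := hlim.comp (tendsto_add_atTop_nat 1)
  have hm1 := CantorSeries.one_le_windowSize hb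
  have hm2 := CantorSeries.two_mul_windowSize_le hb
  obtain ⟨a, ha, hsub⟩ := hf.exists_windowSet_subset (m := CantorSeries.windowSize b)
    (fun n => by have := hm1 n; have := hm2 n; omega) hblim
    (CantorSeries.tendsto_windowSize_div hb hblim)
  refine ENNReal.le_of_forall_nnreal_lt fun r hr => ?_
  have hr1 : r < 1 := by exact_mod_cast hr
  rcases eq_or_ne r 0 with rfl | hr0
  · simp
  have hpos : 0 < r := pos_iff_ne_zero.2 hr0
  exact ((CantorSeries.largeWindows_windowSize hb hblim (by exact_mod_cast hpos)
    (by exact_mod_cast hr1)).le_dimH_windowSet hpos hr1 hm1 hm2 ha).trans (dimH_mono hsub)
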